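/- Let $\{S_n\}_{n\ge 0}$ be a stationary and ergodic process with values in a finite or countably infinite alphabet $\mathcal A$, and let $0<\gamma<1$ and $0<\beta<(1-\gamma)/2$. For $m\ge 0$ say that the process has memory $m$ if, for every $j\ge m$, every $a\in\mathcal A$ and every word $(b_0,\dots,b_{j-1})$ with $\Pr(S_0^{j-1}=b_0^{j-1})>0$, $$\Pr(S_j=a\mid S_0^{j-1}=b_0^{j-1})=\Pr(S_j=a\mid S_{j-m}^{j-1}=b_{j-m}^{j-1}),$$ where $x_u^v=(x_u,\dots,x_v)$, which is the empty word if $v=u-1$. The process is Markov of order $k$ if $k$ is the smallest $m$ such that it has memory $m$. For $n\ge 1$ the estimator is computed from the data $S_0,\dots,S_n$ as follows. Let $h=\lceil n/2\rceil$. For $k\ge 0$ let $\mathcal S^n_k$ be the set of words of length $k+1$ which occur at least once in $S_0^{h-1}$ and occur more than $n^{1-\gamma}$ times in $S_h^n$. For a word $b$ of length $\ell\ge 0$ and $a\in\mathcal A$ let $$C_n(a\mid b)=\frac{\#\{h+\ell\le t\le n: S_{t-\ell}^{t}=(b,a)\}}{\#\{h+\ell-1\le t\le n-1: S_{t-\ell+1}^{t}=b\}},\qquad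 \tfrac00:=0,$$ and let $$\hat\Delta^n_k=\max_{1\le i\le n}\ \max_{(b_{-k-i+1}^0,\,a)\in\mathcal S^n_{k+i}}\bigl|C_n(a\mid b_{-k+1}^0)-C_n(a\mid b_{-k-i+1}^0)\bigr|,$$ where a maximum over the empty set is $0$. Put $D_0=0$, and for $n\ge1$ let $D_n$ be the smallest $k$ with $0\le k<n$ and $\hat\Delta^n_k\le n^{-\beta}$ (such a $k$ exists, since $\hat\Delta^n_{n-1}=0$). Then: 1. if the process is Markov of some finite order $k$, then almost surely $D_n=k$ for all sufficiently large $n$; 2. if the process is not Markov of any finite order, then $D_n\to\infty$ almost surely. -/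

import Mathlib

open MeasureTheory ProbabilityTheory Filter

namespace MarkovOrder

/-! ### The process -/

section Law

variable {Ω A : Type*}

/-- The trajectory `(X 0 ω, X 1 ω, X 2 ω, …)`. -/
def path (X : ℕ → Ω → A) (ω : Ω) : ℕ → A := fun n => X n ω

/-- The left shift `(x 0, x 1, …) ↦ (x 1, x 2, …)` on one-sided sequences. -/
def shift (x : ℕ → A) : ℕ → A := fun n => x (n + 1)

/-- The block `(x s, …, x (s + L - 1))` of length `L` starting at time `s`. -/
def block (x : ℕ → A) (s L : ℕ) : Fin L → A := fun j => x (s + j)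

/-- The last `k` letters of a word of length `i + k`. -/
def lastLetters {i k : ℕ} (b : Fin (i + k) → A) : Fin k → A := fun j => b (Fin.natAdd i j)

variable [MeasurableSpace Ω] [MeasurableSpace A]

/-- The process is stationary: its law on sequence space is invariant under the shift. -/
def IsStationary (P : Measure Ω) (X : ℕ → Ω → A) : Prop :=
  MeasurePreserving shift (P.map (path X)) (P.map (path X))

/-- The process is ergodic: every shift-invariant measurable set of sequences has
probability zero or has a complement of probability zero under the law of the process. -/
def IsErgodic (P : Measure Ω) (X : ℕ → Ω → A) : Prop :=
  PreErgodic shift (P.map (path X))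

/-- The process has the Markov property with memory `k`: given a past
`(X 0, …, X (i + k - 1)) = b` of positive probability, the conditional probability that
`X (i + k) = a` is the conditional probability given the last `k` letters of that past. -/
def HasMemory (P : Measure Ω) (X : ℕ → Ω → A) (k : ℕ) : Prop :=
  ∀ (i : ℕ) (b : Fin (i + k) → A) (a : A),
    0 < P {ω | block (path X ω) 0 (i + k) = b} →
      P[{ω | X (i + k) ω = a} | {ω | block (path X ω) 0 (i + k) = b}] =
        P[{ω | X (i + k) ω = a} | {ω | block (path X ω) i k = lastLetters b}]

/-- The process is Markov of order `k`: `k` is the smallest memory length with which it has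
the Markov property (`k = 0` for an independent sequence). -/
def IsMarkovOfOrder (P : Measure Ω) (X : ℕ → Ω → A) (k : ℕ) : Prop :=
  IsLeast {m | HasMemory P X m} k

end Law

/-! ### The statistics

They are functions of the data `x 0, …, x n`. The data are divided into the first part
`x 0, …, x (⌈n/2⌉ - 1)` and the second part `x ⌈n/2⌉, …, x n`. -/

section Statistics

variable {A : Type*}

/-- `⌈n / 2⌉`. -/
def half (n : ℕ) : ℕ := (n + 1) / 2

open Classical in
/-- The number of occurrences of the word `w` in the segment `x m, …, x (N - 1)`, that is, of
starting times `s` with `m ≤ s` and `s + L ≤ N` at which the letters of `w` are read.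
(The empty word occurs `N - m + 1` times when `m ≤ N`.) -/
noncomputable def occurrences (x : ℕ → A) {L : ℕ} (w : Fin L → A) (m N : ℕ) : ℕ :=
  {s ∈ Finset.Icc m N | s + L ≤ N ∧ block x s L = w}.card

/-- The words of length `k + 1` that occur at all in the first part `x 0, …, x (⌈n/2⌉ - 1)`. -/
def seenWords (x : ℕ → A) (n k : ℕ) : Set (Fin (k + 1) → A) :=
  {w | 0 < occurrences x w 0 (half n)}

/-- The words of length `k + 1` that occur more than `n ^ (1 - γ)` times in the second part
`x ⌈n/2⌉, …, x n`. -/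
def frequentWords (γ : ℝ) (x : ℕ → A) (n k : ℕ) : Set (Fin (k + 1) → A) :=
  {w | (n : ℝ) ^ (1 - γ) < (occurrences x w (half n) (n + 1) : ℝ)}

/-- The words of length `k + 1` that the estimator uses. -/
def words (γ : ℝ) (x : ℕ → A) (n k : ℕ) : Set (Fin (k + 1) → A) :=
  seenWords x n k ∩ frequentWords γ x n k

/-- The empirical conditional probability of the next letter `a` given the word `b`, from the
data `x n₁, …, x n₂`: the number of occurrences of `b` followed by `a` in `x n₁, …, x n₂`,
divided by the number of occurrences of `b` in `x n₁, …, x (n₂ - 1)`, with `0 / 0 = 0`. -/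
noncomputable def empCond (x : ℕ → A) {k : ℕ} (b : Fin k → A) (a : A) (n₁ n₂ : ℕ) : ℝ :=
  (occurrences x (Fin.snoc (α := fun _ => A) b a) n₁ (n₂ + 1) : ℝ) /
    (occurrences x b n₁ n₂ : ℝ)

/-- The differences between the empirical conditional probabilities given a word `b` of
length `k + i` and given its last `k` letters, over `1 ≤ i ≤ n` and over all words `b a`
of length `k + i + 1` that the estimator uses. -/
def deviations (γ : ℝ) (x : ℕ → A) (n k : ℕ) : Set ℝ :=
  {r | ∃ i : ℕ, 1 ≤ i ∧ i ≤ n ∧ ∃ (b : Fin (i + k) → A) (a : A),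
    Fin.snoc (α := fun _ => A) b a ∈ words γ x n (i + k) ∧
    r = |empCond x (lastLetters b) a (half n) n - empCond x b a (half n) n|}

/-- The maximum of the deviations (finitely many nonnegative numbers); it is `0` if there
are none. -/
noncomputable def deltaHat (γ : ℝ) (x : ℕ → A) (n k : ℕ) : ℝ :=
  sSup ({0} ∪ deviations γ x n k)

/-- The order estimator: `0` for `n = 0`, and for `n ≥ 1` the smallest `k < n` whose maximal
deviation is at most `n ^ (-β)`. Such a `k` exists: `k = n - 1` has no deviations, as no
word of length `n + 1` or more occurs in `x 0, …, x (⌈n/2⌉ - 1)`. -/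
noncomputable def orderEst (γ β : ℝ) (x : ℕ → A) (n : ℕ) : ℕ :=
  if n = 0 then 0 else sInf {k : ℕ | k < n ∧ deltaHat γ x n k ≤ (n : ℝ) ^ (-β)}

end Statistics

end MarkovOrder

/-! If memory `k` fails, some word `b a` of positive probability has different probabilities of `a`
given `b` and given the last `k` letters of `b`. By the ergodic theorem `b a` is eventually seen,
its count grows linearly and so exceeds n^(1-γ), and the empirical deviation has a positive limit
while n^(-β) tends to 0 (`ae_eventually_lt_deltaHat`).

If memory `k` holds, both empirical probabilities in a deviation estimate the same number, and an
exponential supermartingale bounds the error for one fixed word. The alphabet may be infinite, so a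
union bound over words with a uniform bound fails. This is why words must be seen in the first half:
for a fixed position, the events that a given word stands there are disjoint and determined by the
first half, so the bounds, each weighted by the probability of its event, add up to at most a single
bound. The union then costs only polynomially many positions and lengths
(`measure_deviationSet_le`), against an error exp(-n^(1-γ-2β)/16). Borel–Cantelli concludes
(`ae_eventually_deltaHat_le`). -/

namespace MarkovOrder

/-! ### The pointwise ergodic theorem for bounded functions -/

section Birkhoff

open Topology

variable {α : Type*}

/-- The maximum of the Birkhoff sums of `g` of lengths `0, …, n`. -/
noncomputable def maxBirkhoffSum (T : α → α) (g : α → ℝ) : ℕ → α → ℝ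
  | 0, _ => 0
  | n + 1, x => max 0 (g x + maxBirkhoffSum T g n (T x))

variable {T : α → α} {g : α → ℝ}

lemma maxBirkhoffSum_nonneg (n : ℕ) (x : α) : 0 ≤ maxBirkhoffSum T g n x := by
  cases n with
  | zero => exact le_rfl
  | succ n => exact le_max_left _ _

lemma maxBirkhoffSum_le_succ (n : ℕ) (x : α) :
    maxBirkhoffSum T g n x ≤ maxBirkhoffSum T g (n + 1) x := by
  induction n generalizing x with
  | zero => exact maxBirkhoffSum_nonneg _ _
  | succ n ih =>
    have := ih (T x)
    exact max_le_max le_rfl (by linarith)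

lemma maxBirkhoffSum_mono (x : α) : Monotone fun n => maxBirkhoffSum T g n x :=
  monotone_nat_of_le_succ fun n => maxBirkhoffSum_le_succ n x

lemma birkhoffSum_le_maxBirkhoffSum (n : ℕ) (x : α) :
    birkhoffSum T g n x ≤ maxBirkhoffSum T g n x := by
  induction n generalizing x with
  | zero => simp [maxBirkhoffSum]
  | succ n ih =>
    rw [birkhoffSum_succ']
    exact le_max_of_le_right (by linarith [ih (T x)])

lemma maxBirkhoffSum_le {C : ℝ} (hC : ∀ x, |g x| ≤ C) (n : ℕ) (x : α) :
    maxBirkhoffSum T g n x ≤ n * C := by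
  have hC0 : 0 ≤ C := (abs_nonneg _).trans (hC x)
  induction n generalizing x with
  | zero => simp [maxBirkhoffSum]
  | succ n ih =>
    refine max_le (by positivity) ?_
    have := ih (T x)
    have := (abs_le.1 (hC x)).2
    push_cast
    linarith

/-- The left side has nonnegative integral under an invariant measure; the right side equals `g x`
once the maximum at `T x` is large. Comparing the two gives the maximal inequality. -/
lemma maxBirkhoffSum_succ_sub (n : ℕ) (x : α) :
    maxBirkhoffSum T g (n + 1) x - maxBirkhoffSum T g n (T x)
      = max (-maxBirkhoffSum T g n (T x)) (g x) := by
  rw [maxBirkhoffSum, ← max_sub_sub_right]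
  congr 1 <;> ring

variable [MeasurableSpace α] {μ : Measure α}

lemma measurable_maxBirkhoffSum (hT : Measurable T) (hg : Measurable g) (n : ℕ) :
    Measurable (maxBirkhoffSum T g n) := by
  induction n with
  | zero => exact measurable_const
  | succ n ih => exact measurable_const.max (hg.add (ih.comp hT))

lemma integrable_maxBirkhoffSum [IsProbabilityMeasure μ] (hT : Measurable T) (hg : Measurable g)
    {C : ℝ} (hC : ∀ x, |g x| ≤ C) (n : ℕ) : Integrable (maxBirkhoffSum T g n) μ := by
  refine Integrable.of_bound (measurable_maxBirkhoffSum hT hg n).aestronglyMeasurable (n * C)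
    (ae_of_all _ fun x => ?_)
  rw [Real.norm_of_nonneg (maxBirkhoffSum_nonneg n x)]
  exact maxBirkhoffSum_le hC n x

/-- If `g` has negative mean, then its Birkhoff sums are almost surely bounded above. -/
lemma ae_bddAbove_birkhoffSum [IsProbabilityMeasure μ] (hT : MeasurePreserving T μ μ)
    (hE : PreErgodic T μ) (hg : Measurable g) {C : ℝ} (hC : ∀ x, |g x| ≤ C)
    (hneg : ∫ x, g x ∂μ < 0) :
    ∀ᵐ x ∂μ, ∃ K : ℕ, ∀ n, birkhoffSum T g n x ≤ K := by
  set B : Set α := {x | ∀ K : ℕ, ∃ n, (K : ℝ) < maxBirkhoffSum T g n x} with hB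
  have hBm : MeasurableSet B := by
    have : B = ⋂ K : ℕ, ⋃ n, {x | (K : ℝ) < maxBirkhoffSum T g n x} := by
      ext x; simp [hB]
    rw [this]
    exact MeasurableSet.iInter fun K => MeasurableSet.iUnion fun n =>
      measurableSet_lt measurable_const (measurable_maxBirkhoffSum hT.measurable hg n)
  -- When positive, the maximum at `x` of index `n + 1` differs from that of index `n` at `T x` by
  -- at most `C`; raising the level by `c > C` absorbs this.
  have hBT : T ⁻¹' B = B := by
    ext x
    have hgx := abs_le.1 (hC x)
    obtain ⟨c, hc⟩ := exists_nat_gt C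
    constructor
    · intro h K
      obtain ⟨n, hn⟩ := h (K + c)
      refine ⟨n + 1, lt_max_of_lt_right ?_⟩
      push_cast at hn
      linarith
    · intro h K
      obtain ⟨n, hn⟩ := h (K + c)
      have hn' := hn.trans_le (maxBirkhoffSum_le_succ n x)
      push_cast at hn'
      refine ⟨n, ?_⟩
      rcases lt_max_iff.1 hn' with h1 | h1
      · have : (0 : ℝ) ≤ K := Nat.cast_nonneg _
        have : (0 : ℝ) ≤ c := Nat.cast_nonneg _
        linarith
      · linarith
  rcases hE.ae_mem_or_ae_notMem hBm hBT with h | h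
  -- If the maxima were almost surely unbounded, the integrals of the differences, which are
  -- nonnegative, would converge to the negative integral of `g`.
  · exfalso
    have hint := fun n => integrable_maxBirkhoffSum (μ := μ) hT.measurable hg hC n
    have hlim : Tendsto (fun n => ∫ x, max (-maxBirkhoffSum T g n (T x)) (g x) ∂μ) atTop
        (𝓝 (∫ x, g x ∂μ)) := by
      refine tendsto_integral_of_dominated_convergence (fun _ => C)
        (fun n => (((measurable_maxBirkhoffSum hT.measurable hg n).comp
          hT.measurable).neg.max hg).aestronglyMeasurable) (integrable_const C) ?_ ?_
      · refine fun n => ae_of_all _ fun x => ?_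
        have h1 := abs_le.1 (hC x)
        have h2 := maxBirkhoffSum_nonneg (T := T) (g := g) n (T x)
        exact abs_le.2 ⟨le_max_of_le_right h1.1, max_le (by linarith) h1.2⟩
      · filter_upwards [h] with x hx
        rw [← hBT] at hx
        obtain ⟨c, hc⟩ := exists_nat_gt C
        obtain ⟨n, hn⟩ := hx c
        refine tendsto_const_nhds.congr' ?_
        filter_upwards [eventually_ge_atTop n] with m hm
        have h1 := abs_le.1 (hC x)
        have h2 := maxBirkhoffSum_mono (T := T) (g := g) (T x) hm
        simp only at h2
        rw [max_eq_right]
        linarith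
    refine absurd (ge_of_tendsto' hlim fun n => ?_) (not_le.2 hneg)
    simp_rw [← maxBirkhoffSum_succ_sub]
    have hcint : Integrable (fun x => maxBirkhoffSum T g n (T x)) μ :=
      (hT.integrable_comp (hint n).aestronglyMeasurable).2 (hint n)
    rw [integral_sub (hint _) hcint]
    have hcomp : ∫ x, maxBirkhoffSum T g n (T x) ∂μ = ∫ x, maxBirkhoffSum T g n x ∂μ := by
      conv_rhs => rw [← hT.map_eq]
      rw [integral_map hT.measurable.aemeasurable]
      exact (measurable_maxBirkhoffSum hT.measurable hg n).aestronglyMeasurable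
    rw [hcomp, sub_nonneg]
    exact integral_mono (hint _) (hint _) fun x => maxBirkhoffSum_le_succ n x
  · filter_upwards [h] with x hx
    simp only [hB, Set.mem_ofPred_eq, not_forall, not_exists, not_lt] at hx
    obtain ⟨K, hK⟩ := hx
    exact ⟨K, fun n => (birkhoffSum_le_maxBirkhoffSum n x).trans (hK n)⟩

/-- The pointwise ergodic theorem for bounded measurable functions. -/
theorem ae_tendsto_birkhoffSum_div [IsProbabilityMeasure μ] (hT : MeasurePreserving T μ μ)
    (hE : PreErgodic T μ) (hg : Measurable g) {C : ℝ} (hC : ∀ x, |g x| ≤ C) :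
    ∀ᵐ x ∂μ, Tendsto (fun n : ℕ => birkhoffSum T g n x / n) atTop (𝓝 (∫ x, g x ∂μ)) := by
  set I := ∫ x, g x ∂μ with hI
  have hgi : Integrable g μ :=
    Integrable.of_bound hg.aestronglyMeasurable C (ae_of_all _ hC)
  have hsum : ∀ (σ c : ℝ) (n : ℕ) (x : α),
      birkhoffSum T (fun y => σ * g y + c) n x = σ * birkhoffSum T g n x + n * c := by
    intro σ c n x
    simp [birkhoffSum, Finset.sum_add_distrib, Finset.mul_sum]
  -- Centring and subtracting 1/(m+1) makes the mean negative; σ = 1 and σ = -1 give the upper and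
  -- lower bounds.
  have key : ∀ (σ : ℝ) (m : ℕ), ∀ᵐ x ∂μ, ∃ K : ℕ, ∀ n : ℕ,
      σ * birkhoffSum T g n x + n * (-σ * I - 1 / (m + 1)) ≤ K := by
    intro σ m
    have := ae_bddAbove_birkhoffSum (μ := μ) hT hE
      (g := fun y => σ * g y + (-σ * I - 1 / (m + 1))) ((hg.const_mul σ).add_const _)
      (C := |σ| * C + |(-σ * I - 1 / (m + 1))|) (fun x => (abs_add_le _ _).trans (by
        rw [abs_mul]; gcongr; exact hC x))
      (by
        rw [integral_add (hgi.const_mul σ) (integrable_const _), integral_const_mul, ← hI]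
        have : (0 : ℝ) < 1 / (m + 1) := by positivity
        simp only [integral_const, probReal_univ, one_smul]
        linarith)
    simpa only [hsum] using this
  filter_upwards [ae_all_iff.2 (key 1), ae_all_iff.2 (key (-1))] with x h1 h2
  rw [Metric.tendsto_atTop]
  intro ε hε
  obtain ⟨m, hm⟩ := exists_nat_one_div_lt (half_pos hε)
  obtain ⟨K₁, hK₁⟩ := h1 m
  obtain ⟨K₂, hK₂⟩ := h2 m
  obtain ⟨N, hN⟩ := exists_nat_gt ((K₁ + K₂) / (ε / 2))
  refine ⟨N + 1, fun n hn => ?_⟩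
  have hn0 : (0 : ℝ) < n := by exact_mod_cast (by omega : 0 < n)
  have hNn : (N : ℝ) < n := by exact_mod_cast (by omega : N < n)
  have hb : (K₁ + K₂ : ℝ) < n * (ε / 2) := by
    rw [div_lt_iff₀ (half_pos hε)] at hN
    nlinarith
  have hd : birkhoffSum T g n x / n - I = (birkhoffSum T g n x - n * I) / n := by
    field_simp
  rw [Real.dist_eq, hd, abs_div, abs_of_pos hn0, div_lt_iff₀ hn0, abs_lt]
  have e1 := hK₁ n
  have e2 := hK₂ n
  have e3 : (n : ℝ) * (1 / (m + 1)) < n * (ε / 2) := by gcongr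
  have e4 : (0 : ℝ) ≤ K₁ := Nat.cast_nonneg _
  have e5 : (0 : ℝ) ≤ K₂ := Nat.cast_nonneg _
  constructor <;> nlinarith

end Birkhoff

/-! ### Words and their occurrences -/

section Words

variable {A : Type*}

lemma block_eq_iff {x : ℕ → A} {s L : ℕ} {w : Fin L → A} :
    block x s L = w ↔ ∀ j : Fin L, x (s + j) = w j := funext_iff

lemma block_succ_eq_snoc_iff {x : ℕ → A} {s L : ℕ} {b : Fin L → A} {a : A} :
    block x s (L + 1) = Fin.snoc (α := fun _ => A) b a ↔ block x s L = b ∧ x (s + L) = a := by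
  simp only [block_eq_iff, Fin.forall_fin_succ', Fin.snoc_castSucc, Fin.snoc_last,
    Fin.val_castSucc, Fin.val_last]

lemma lastLetters_block (x : ℕ → A) (s i k : ℕ) :
    lastLetters (block x s (i + k)) = block x (s + i) k := by
  ext j
  simp [lastLetters, block, add_assoc]

lemma block_lastLetters {x : ℕ → A} {s i k : ℕ} {b : Fin (i + k) → A}
    (h : block x s (i + k) = b) : block x (s + i) k = lastLetters b := by
  rw [← lastLetters_block, h]

lemma shift_iterate_apply (x : ℕ → A) (s j : ℕ) : shift^[s] x j = x (s + j) := by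
  induction s generalizing x with
  | zero => simp
  | succ s ih =>
    rw [Function.iterate_succ_apply, ih]
    simp only [shift]
    congr 1
    omega

lemma block_shift_iterate (x : ℕ → A) (s t L : ℕ) :
    block (shift^[s] x) t L = block x (s + t) L := by
  ext j
  simp [block, shift_iterate_apply, add_assoc]

lemma block_inter_coord (s : ℕ) {L : ℕ} (w : Fin L → A) (a : A) :
    {x : ℕ → A | block x s L = w} ∩ {x | x (s + L) = a}
      = {x | block x s (L + 1) = Fin.snoc (α := fun _ => A) w a} := by
  ext x
  simp [block_succ_eq_snoc_iff]

lemma block_congr {x y : ℕ → A} {s L t : ℕ} (h : ∀ j < t, x j = y j) (hs : s + L ≤ t) :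
    block x s L = block y s L := by
  ext j
  exact h _ (by omega)

open Classical in
lemma occurrences_eq_sum (x : ℕ → A) {L : ℕ} (w : Fin L → A) (m N : ℕ) :
    occurrences x w m N
      = ∑ s ∈ Finset.range (N + 1 - (m + L)), if block x (m + s) L = w then 1 else 0 := by
  rw [← Finset.card_filter]
  unfold occurrences
  refine (Finset.card_bij (fun s _ => m + s) ?_ ?_ ?_).symm
  · intro s hs
    simp only [Finset.mem_filter, Finset.mem_range, Finset.mem_Icc] at hs ⊢
    exact ⟨by omega, by omega, hs.2⟩
  · intro s _ t _ h
    simpa using h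
  · intro s hs
    simp only [Finset.mem_filter, Finset.mem_range, Finset.mem_Icc] at hs ⊢
    refine ⟨s - m, ⟨by omega, ?_⟩, by omega⟩
    rw [Nat.add_sub_cancel' hs.1.1]
    exact hs.2.2

lemma occurrences_pos_iff {x : ℕ → A} {L : ℕ} {w : Fin L → A} {N : ℕ} :
    0 < occurrences x w 0 N ↔ ∃ s, s + L ≤ N ∧ block x s L = w := by
  classical
  simp only [occurrences, Finset.card_pos, Finset.Nonempty, Finset.mem_filter, Finset.mem_Icc]
  constructor
  · rintro ⟨s, -, h⟩
    exact ⟨s, h⟩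
  · rintro ⟨s, h⟩
    exact ⟨s, by omega, h⟩

lemma occurrences_snoc_le (x : ℕ → A) {L : ℕ} (b : Fin L → A) (a : A) (m N : ℕ) :
    occurrences x (Fin.snoc (α := fun _ => A) b a) m (N + 1) ≤ occurrences x b m N := by
  classical
  unfold occurrences
  refine Finset.card_le_card fun s hs => ?_
  simp only [Finset.mem_filter, Finset.mem_Icc, block_succ_eq_snoc_iff] at hs ⊢
  exact ⟨by omega, by omega, hs.2.2.1⟩

lemma occurrences_le_lastLetters (x : ℕ → A) {i k : ℕ} (b : Fin (i + k) → A) (m N : ℕ) :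
    occurrences x b m N ≤ occurrences x (lastLetters b) m N := by
  classical
  unfold occurrences
  refine Finset.card_le_card_of_injOn (fun s => s + i) (fun s hs => ?_) (by simp [Set.InjOn])
  simp only [Finset.coe_filter, Set.mem_ofPred_eq, Finset.mem_Icc] at hs ⊢
  exact ⟨by omega, by omega, block_lastLetters hs.2.2⟩

/-- Being seen passes to suffixes, so the error bound for words of length `k` also covers the
shorter word in each deviation. -/
lemma seen_lastLetters {x : ℕ → A} {i k N : ℕ} {b : Fin (i + k) → A} {a : A}
    (h : 0 < occurrences x (Fin.snoc (α := fun _ => A) b a) 0 N) :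
    0 < occurrences x (Fin.snoc (α := fun _ => A) (lastLetters b) a) 0 N := by
  rw [occurrences_pos_iff] at h ⊢
  obtain ⟨s, hs, h⟩ := h
  rw [block_succ_eq_snoc_iff] at h
  refine ⟨s + i, by omega, block_succ_eq_snoc_iff.2 ⟨block_lastLetters h.1, ?_⟩⟩
  rw [← h.2, add_assoc]

lemma half_le (n : ℕ) : half n ≤ n := by unfold half; omega

lemma empCond_nonneg (x : ℕ → A) {L : ℕ} (b : Fin L → A) (a : A) (m N : ℕ) :
    0 ≤ empCond x b a m N := by
  unfold empCond; positivity

lemma empCond_le_one (x : ℕ → A) {L : ℕ} (b : Fin L → A) (a : A) (m N : ℕ) :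
    empCond x b a m N ≤ 1 :=
  div_le_one_of_le₀ (by exact_mod_cast occurrences_snoc_le x b a m N) (Nat.cast_nonneg _)

lemma le_deltaHat {γ : ℝ} {x : ℕ → A} {n k : ℕ} {r : ℝ} (hr : r ∈ deviations γ x n k) :
    r ≤ deltaHat γ x n k := by
  refine le_csSup ⟨1, ?_⟩ (Or.inr hr)
  rintro r (rfl | ⟨i, -, -, b, a, -, rfl⟩)
  · exact zero_le_one
  · have h1 := empCond_nonneg x (lastLetters b) a (half n) n
    have h2 := empCond_nonneg x b a (half n) n
    have h3 := empCond_le_one x (lastLetters b) a (half n) n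
    have h4 := empCond_le_one x b a (half n) n
    exact abs_le.2 ⟨by linarith, by linarith⟩

lemma deltaHat_le {γ c : ℝ} {x : ℕ → A} {n k : ℕ} (hc : 0 ≤ c)
    (h : ∀ r ∈ deviations γ x n k, r ≤ c) : deltaHat γ x n k ≤ c := by
  refine csSup_le ⟨0, Or.inl rfl⟩ ?_
  rintro r (rfl | hr)
  · exact hc
  · exact h r hr

lemma deltaHat_pred_le (γ : ℝ) (x : ℕ → A) (n : ℕ) :
    deltaHat γ x n (n - 1) ≤ 0 := by
  refine deltaHat_le le_rfl ?_
  rintro r ⟨i, hi, -, b, a, ⟨hseen, -⟩, -⟩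
  obtain ⟨s, hs, -⟩ := occurrences_pos_iff.1 hseen
  unfold half at hs
  omega

lemma orderEst_le {γ β : ℝ} {x : ℕ → A} {n k : ℕ} (hkn : k < n)
    (h : deltaHat γ x n k ≤ (n : ℝ) ^ (-β)) : orderEst γ β x n ≤ k := by
  rw [orderEst, if_neg (by omega)]
  exact Nat.sInf_le ⟨hkn, h⟩

lemma le_orderEst {γ β : ℝ} {x : ℕ → A} {n k : ℕ} (hn : n ≠ 0)
    (h : ∀ j < k, (n : ℝ) ^ (-β) < deltaHat γ x n j) : k ≤ orderEst γ β x n := by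
  rw [orderEst, if_neg hn]
  -- Nonemptiness matters here: the infimum of the empty set would be 0.
  refine le_csInf ⟨n - 1, by omega, (deltaHat_pred_le γ x n).trans (by positivity)⟩ ?_
  rintro j ⟨-, hj⟩
  by_contra! hjk
  exact (h j hjk).not_ge hj

end Words

/-! ### Cylinder probabilities and empirical frequencies -/

section Frequencies

open Topology

variable {A : Type*} [MeasurableSpace A] {μ : Measure (ℕ → A)}

lemma measurable_block (s L : ℕ) : Measurable fun x : ℕ → A => block x s L :=
  measurable_pi_lambda _ fun _ => measurable_pi_apply _

/-- The conditional probability of the letter `a` after the word `w`. -/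
noncomputable def transProb (μ : Measure (ℕ → A)) {L : ℕ} (w : Fin L → A) (a : A) : ℝ :=
  μ.real {x | block x 0 (L + 1) = Fin.snoc (α := fun _ => A) w a} / μ.real {x | block x 0 L = w}

lemma transProb_nonneg {L : ℕ} (w : Fin L → A) (a : A) : 0 ≤ transProb μ w a := by
  unfold transProb; positivity

variable [Countable A] [DiscreteMeasurableSpace A]

lemma measurableSet_block (s : ℕ) {L : ℕ} (w : Fin L → A) :
    MeasurableSet {x : ℕ → A | block x s L = w} :=
  measurable_block s L (measurableSet_singleton w)

lemma measurableSet_coord (n : ℕ) (a : A) : MeasurableSet {x : ℕ → A | x n = a} :=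
  (measurable_pi_apply n : Measurable fun x : ℕ → A => x n) (measurableSet_singleton a)

lemma measure_block (hT : MeasurePreserving shift μ μ) (s : ℕ) {L : ℕ} (w : Fin L → A) :
    μ {x | block x s L = w} = μ {x | block x 0 L = w} := by
  rw [← (hT.iterate s).measure_preimage (measurableSet_block 0 w).nullMeasurableSet]
  simp [Set.preimage, block_shift_iterate]

/-- Stationarity removes the dependence on `s`; for a null block both sides are 0. -/
lemma cond_block_coord [IsProbabilityMeasure μ] (hT : MeasurePreserving shift μ μ)
    (s : ℕ) {L : ℕ} (w : Fin L → A) (a : A) :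
    μ[{x | x (s + L) = a} | {x | block x s L = w}] = ENNReal.ofReal (transProb μ w a) := by
  rw [cond_apply (measurableSet_block s w), block_inter_coord, measure_block hT s w, measure_block hT s,
    transProb, mul_comm]
  by_cases h : μ {x | block x 0 L = w} = 0
  · have : μ {x | block x 0 (L + 1) = Fin.snoc (α := fun _ => A) w a} = 0 := by
      rw [← block_inter_coord 0]
      exact measure_mono_null Set.inter_subset_left h
    simp [this, Measure.real]
  · simp only [Measure.real]
    rw [ENNReal.ofReal_div_of_pos
      (ENNReal.toReal_pos h (measure_ne_top _ _)), ENNReal.ofReal_toReal (measure_ne_top _ _),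
      ENNReal.ofReal_toReal (measure_ne_top _ _), div_eq_mul_inv]

/-- The Markov property with memory `k` of the coordinate process, in terms of the conditional
probabilities of the next letter. -/
lemma hasMemory_iff [IsProbabilityMeasure μ] (hT : MeasurePreserving shift μ μ) (k : ℕ) :
    HasMemory μ (fun n x => x n) k ↔ ∀ (i : ℕ) (b : Fin (i + k) → A) (a : A),
      0 < μ {x | block x 0 (i + k) = b} → transProb μ b a = transProb μ (lastLetters b) a := by
  unfold HasMemory path
  refine forall_congr' fun i => forall_congr' fun b => forall_congr' fun a => imp_congr_right
    fun _ => ?_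
  have h := cond_block_coord hT 0 b a
  rw [Nat.zero_add] at h
  rw [h, cond_block_coord hT i (lastLetters b) a,
    ENNReal.ofReal_eq_ofReal_iff (transProb_nonneg _ _) (transProb_nonneg _ _)]

/-- A process without memory `k` has a word `b a` of positive probability for which the
conditional probabilities of `a` given `b` and given the last `k` letters of `b` differ. -/
lemma exists_transProb_ne [IsProbabilityMeasure μ] (hT : MeasurePreserving shift μ μ) {k : ℕ}
    (hk : ¬ HasMemory μ (fun n x => x n) k) :
    ∃ (i : ℕ) (b : Fin (i + k) → A) (a : A), 1 ≤ i ∧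
      0 < μ {x | block x 0 (i + k + 1) = Fin.snoc (α := fun _ => A) b a} ∧
      transProb μ b a ≠ transProb μ (lastLetters b) a := by
  rw [hasMemory_iff hT] at hk
  push Not at hk
  obtain ⟨i, b, a, hb, hne⟩ := hk
  have hi : 1 ≤ i := by
    by_contra! hi
    obtain rfl : i = 0 := by omega
    refine hne ?_
    have hc := cond_block_coord hT 0 b a
    have hc' := cond_block_coord hT 0 (lastLetters b) a
    have hev : {x : ℕ → A | block x 0 (0 + k) = b} = {x | block x 0 k = lastLetters b} := by
      ext x
      constructor
      · exact fun h => block_lastLetters h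
      · intro h
        have h' := block_eq_iff.1 h
        refine block_eq_iff.2 fun j => ?_
        have := h' ⟨j, by omega⟩
        simp only [lastLetters] at this
        rw [this]
        congr 1
        ext
        simp
    rw [hev] at hc
    simp only [Nat.zero_add] at hc hc'
    rw [hc] at hc'
    exact (ENNReal.ofReal_eq_ofReal_iff (transProb_nonneg _ _) (transProb_nonneg _ _)).1 hc'
  -- The letter `a` found above may have probability 0 after `b`, so another letter may be needed.
  -- If equality held at every letter possible after `b`, the next-letter law given `b` would lie
  -- below the law given the suffix; both have mass 1, so they would coincide.
  by_contra! hall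
  have hlast : 0 < μ {x | block x i k = lastLetters b} :=
    hb.trans_le (measure_mono fun x hx => by simpa using block_lastLetters hx)
  set ν₁ := (μ[|{x | block x 0 (i + k) = b}]).map fun x => x (i + k) with hν₁
  set ν₂ := (μ[|{x | block x i k = lastLetters b}]).map fun x => x (i + k) with hν₂
  have hp₁ : IsProbabilityMeasure (μ[|{x | block x 0 (i + k) = b}]) :=
    cond_isProbabilityMeasure hb.ne'
  have hp₂ : IsProbabilityMeasure (μ[|{x | block x i k = lastLetters b}]) :=
    cond_isProbabilityMeasure hlast.ne'
  have hm : Measurable fun x : ℕ → A => x (i + k) := measurable_pi_apply _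
  have : IsProbabilityMeasure ν₁ := Measure.isProbabilityMeasure_map hm.aemeasurable
  have : IsProbabilityMeasure ν₂ := Measure.isProbabilityMeasure_map hm.aemeasurable
  have h₁ : ∀ a, ν₁ {a} = ENNReal.ofReal (transProb μ b a) := fun a => by
    rw [hν₁, Measure.map_apply hm (measurableSet_singleton a)]
    have := cond_block_coord hT 0 b a
    rwa [Nat.zero_add] at this
  have h₂ : ∀ a, ν₂ {a} = ENNReal.ofReal (transProb μ (lastLetters b) a) := fun a => by
    rw [hν₂, Measure.map_apply hm (measurableSet_singleton a)]
    exact cond_block_coord hT i (lastLetters b) a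
  have hle : ∀ a, ν₁ {a} ≤ ν₂ {a} := by
    intro a
    rw [h₁, h₂]
    rcases eq_zero_or_pos (μ {x | block x 0 (i + k + 1) = Fin.snoc (α := fun _ => A) b a}) with h | h
    · simp [transProb, Measure.real, h]
    · rw [hall i b a hi h]
  have heq : ν₁ = ν₂ := by
    refine Measure.eq_of_le_of_measure_univ_eq (Measure.le_iff.2 fun s _ => ?_) (by simp)
    rw [← Measure.tsum_indicator_apply_singleton ν₁ s .of_discrete,
      ← Measure.tsum_indicator_apply_singleton ν₂ s .of_discrete]
    exact ENNReal.tsum_le_tsum fun a => Set.indicator_le_indicator (hle a)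
  refine hne ((ENNReal.ofReal_eq_ofReal_iff (transProb_nonneg _ _) (transProb_nonneg _ _)).1 ?_)
  rw [← h₁, ← h₂, heq]

open Classical in
/-- Almost surely every word occurs with its limiting frequency. -/
lemma ae_tendsto_frequency [IsProbabilityMeasure μ] (hT : MeasurePreserving shift μ μ)
    (hE : PreErgodic shift μ) {L : ℕ} (w : Fin L → A) :
    ∀ᵐ x ∂μ, Tendsto
      (fun n : ℕ => (∑ s ∈ Finset.range n, if block x s L = w then (1 : ℝ) else 0) / n) atTop
      (𝓝 (μ.real {x | block x 0 L = w})) := by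
  have h := ae_tendsto_birkhoffSum_div (C := 1) hT hE
    (g := Set.indicator {x | block x 0 L = w} fun _ => (1 : ℝ))
    (measurable_const.indicator (measurableSet_block 0 w))
    (fun x => by by_cases hx : block x 0 L = w <;> simp [hx])
  rw [integral_indicator_const _ (measurableSet_block 0 w)] at h
  simpa [birkhoffSum, Set.indicator_apply, block_shift_iterate] using h

lemma tendsto_half : Tendsto half atTop atTop :=
  tendsto_atTop_mono (fun n => by unfold half; omega : ∀ n, n / 2 ≤ half n)
    (Nat.tendsto_div_const_atTop two_ne_zero)

lemma tendsto_half_div : Tendsto (fun n : ℕ => (half n : ℝ) / n) atTop (𝓝 (1 / 2)) := by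
  have h1 : Tendsto (fun n : ℕ => (1 : ℝ) / 2 + 1 / n) atTop (𝓝 (1 / 2 + 0)) :=
    tendsto_const_nhds.add tendsto_one_div_atTop_nhds_zero_nat
  rw [add_zero] at h1
  refine tendsto_of_tendsto_of_tendsto_of_le_of_le' tendsto_const_nhds h1 ?_ ?_
  all_goals
    filter_upwards [eventually_gt_atTop 0] with n hn
    have hn' : (0 : ℝ) < n := by exact_mod_cast hn
    have e1 : (n : ℝ) ≤ 2 * half n := by
      exact_mod_cast (by unfold half; omega : n ≤ 2 * half n)
    have e2 : (2 * half n : ℝ) ≤ n + 1 := by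
      exact_mod_cast (by unfold half; omega : 2 * half n ≤ n + 1)
  · rw [le_div_iff₀ hn']; linarith
  · rw [div_le_iff₀ hn', add_mul, div_mul_cancel₀ _ hn'.ne']; linarith

/-- The number of occurrences of a word in the second part of the data grows like half the
probability of the word times the sample size. -/
lemma ae_tendsto_occurrences [IsProbabilityMeasure μ] (hT : MeasurePreserving shift μ μ)
    (hE : PreErgodic shift μ) {L : ℕ} (w : Fin L → A) (c : ℕ) :
    ∀ᵐ x ∂μ, Tendsto (fun n : ℕ => (occurrences x w (half n) (n + c) : ℝ) / n) atTop
      (𝓝 (μ.real {x | block x 0 L = w} / 2)) := by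
  classical
  filter_upwards [ae_tendsto_frequency hT hE w] with x hx
  set V : ℕ → ℝ := fun n => ∑ s ∈ Finset.range n, if block x s L = w then (1 : ℝ) else 0 with hV
  set q := μ.real {x | block x 0 L = w}
  have hcomp : ∀ (φ : ℕ → ℕ) (r : ℝ), Tendsto φ atTop atTop →
      Tendsto (fun n => (φ n : ℝ) / n) atTop (𝓝 r) →
      Tendsto (fun n => V (φ n) / n) atTop (𝓝 (q * r)) := by
    intro φ r h1 h2
    refine ((hx.comp h1).mul h2).congr' ?_
    filter_upwards [h1.eventually_gt_atTop 0] with n hn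
    have : (φ n : ℝ) ≠ 0 := by exact_mod_cast hn.ne'
    simp only [Function.comp]
    field_simp
    rfl
  have hend : Tendsto (fun n : ℕ => ((n + c + 1 - L : ℕ) : ℝ) / n) atTop (𝓝 1) := by
    have : Tendsto (fun n : ℕ => (1 : ℝ) + ((c : ℝ) + 1 - L) * (1 / n)) atTop
        (𝓝 (1 + ((c : ℝ) + 1 - L) * 0)) :=
      tendsto_const_nhds.add (tendsto_const_nhds.mul tendsto_one_div_atTop_nhds_zero_nat)
    rw [mul_zero, add_zero] at this
    refine this.congr' ?_
    filter_upwards [eventually_gt_atTop L] with n hn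
    have hn' : (n : ℝ) ≠ 0 := by exact_mod_cast (by omega : n ≠ 0)
    rw [Nat.cast_sub (by omega)]
    push_cast
    field_simp
    ring
  -- The count is that of starting times below `n + c + 1 - L` minus that below `half n`; these
  -- bounds grow like n and n/2.
  have h1 := hcomp (fun n => n + c + 1 - L) 1
    (tendsto_atTop_atTop.2 fun b => ⟨b + L, fun n hn => by omega⟩) hend
  have h2 := hcomp half (1 / 2) tendsto_half tendsto_half_div
  have h3 := h1.sub h2
  rw [show q * 1 - q * (1 / 2) = q / 2 by ring] at h3
  refine h3.congr' ?_
  filter_upwards [eventually_ge_atTop (2 * L + 2)] with n hn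
  rw [← sub_div]
  congr 1
  have hle : half n ≤ n + c + 1 - L := by unfold half; omega
  rw [occurrences_eq_sum, hV]
  simp only
  rw [← Finset.sum_Ico_eq_sub _ hle, Finset.sum_Ico_eq_sum_range]
  push_cast
  congr 2
  omega

lemma ae_eventually_seen [IsProbabilityMeasure μ] (hT : MeasurePreserving shift μ μ)
    (hE : PreErgodic shift μ) {L : ℕ} (w : Fin L → A) (hw : 0 < μ {x | block x 0 L = w}) :
    ∀ᵐ x ∂μ, ∀ᶠ n in atTop, 0 < occurrences x w 0 (half n) := by
  classical
  filter_upwards [ae_tendsto_frequency hT hE w] with x hx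
  have hpos : 0 < μ.real {x | block x 0 L = w} := ENNReal.toReal_pos hw.ne' (measure_ne_top _ _)
  obtain ⟨N, hN⟩ := (hx.eventually (lt_mem_nhds hpos)).exists
  have : ∃ s ∈ Finset.range N, block x s L = w := by
    by_contra! h
    rw [Finset.sum_eq_zero fun s hs => if_neg (h s hs)] at hN
    simp at hN
  obtain ⟨s, -, hs⟩ := this
  filter_upwards [tendsto_half.eventually_ge_atTop (s + L)] with n hn
  exact occurrences_pos_iff.2 ⟨s, hn, hs⟩

lemma ae_tendsto_empCond [IsProbabilityMeasure μ] (hT : MeasurePreserving shift μ μ)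
    (hE : PreErgodic shift μ) {L : ℕ} (w : Fin L → A) (a : A)
    (hw : 0 < μ {x | block x 0 L = w}) :
    ∀ᵐ x ∂μ, Tendsto (fun n => empCond x w a (half n) n) atTop (𝓝 (transProb μ w a)) := by
  filter_upwards [ae_tendsto_occurrences hT hE w 0,
    ae_tendsto_occurrences hT hE (Fin.snoc (α := fun _ => A) w a) 1] with x h1 h2
  have hpos : 0 < μ.real {x | block x 0 L = w} := ENNReal.toReal_pos hw.ne' (measure_ne_top _ _)
  have h := h2.div h1 (by positivity)
  rw [div_div_div_cancel_right₀ two_ne_zero] at h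
  refine h.congr' ?_
  filter_upwards [eventually_gt_atTop 0] with n hn
  have hn' : (n : ℝ) ≠ 0 := by exact_mod_cast hn.ne'
  simp only [Pi.div_apply, div_div_div_cancel_right₀ hn', empCond, add_zero]

/-- If the process does not have memory `k`, then `k` is eventually rejected. -/
theorem ae_eventually_lt_deltaHat [IsProbabilityMeasure μ] (hT : MeasurePreserving shift μ μ)
    (hE : PreErgodic shift μ) {k : ℕ} (hk : ¬ HasMemory μ (fun n x => x n) k) {γ β : ℝ}
    (hγ : 0 < γ) (hβ : 0 < β) :
    ∀ᵐ x ∂μ, ∀ᶠ n : ℕ in atTop, (n : ℝ) ^ (-β) < deltaHat γ x n k := by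
  obtain ⟨i, b, a, hi, hba, hne⟩ := exists_transProb_ne hT hk
  have hb : 0 < μ {x | block x 0 (i + k) = b} :=
    hba.trans_le (measure_mono fun x hx => (block_succ_eq_snoc_iff.1 hx).1)
  have hl : 0 < μ {x | block x 0 k = lastLetters b} := by
    rw [← measure_block hT i]
    exact hb.trans_le (measure_mono fun x hx => by simpa using block_lastLetters hx)
  have hpos : 0 < μ.real {x | block x 0 (i + k + 1) = Fin.snoc (α := fun _ => A) b a} :=
    ENNReal.toReal_pos hba.ne' (measure_ne_top _ _)
  filter_upwards [ae_tendsto_empCond hT hE b a hb, ae_tendsto_empCond hT hE (lastLetters b) a hl,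
    ae_eventually_seen hT hE _ hba, ae_tendsto_occurrences hT hE _ 1] with x h1 h2 hseen hocc
  have hβ' : Tendsto (fun n : ℕ => (n : ℝ) ^ (-β)) atTop (𝓝 0) :=
    (tendsto_rpow_neg_atTop hβ).comp tendsto_natCast_atTop_atTop
  have hγ' : Tendsto (fun n : ℕ => (n : ℝ) ^ (-γ)) atTop (𝓝 0) :=
    (tendsto_rpow_neg_atTop hγ).comp tendsto_natCast_atTop_atTop
  have hdev := hβ'.eventually_lt ((h2.sub h1).abs) (abs_pos.2 (sub_ne_zero.2 hne.symm))
  -- The threshold n^(1-γ) divided by n is n^(-γ), which falls below any positive limit.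
  have hfreq := hγ'.eventually_lt hocc (half_pos hpos)
  filter_upwards [hdev, hfreq, hseen, eventually_ge_atTop (i + 1)] with n hd hf hs hn
  have hn' : (0 : ℝ) < n := by exact_mod_cast (by omega : 0 < n)
  refine hd.trans_le (le_deltaHat ⟨i, hi, by omega, b, a, ⟨hs, ?_⟩, rfl⟩)
  rw [lt_div_iff₀ hn'] at hf
  change (n : ℝ) ^ (1 - γ) < _
  rwa [sub_eq_add_neg, add_comm, Real.rpow_add hn', Real.rpow_one]

end Frequencies

/-! ### Deviations of empirical conditional probabilities -/

section Deviations

open Topology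

/-- Apply e^y ≤ 1 + y + y² to a centred Bernoulli variable: the linear terms cancel, the variance is
at most 1, and 1 + l² ≤ exp(l²). -/
lemma two_point_exp_le {p l : ℝ} (hp0 : 0 ≤ p) (hp1 : p ≤ 1) (hl : |l| ≤ 1) :
    Real.exp (l * (1 - p) - l ^ 2) * p + Real.exp (l * (0 - p) - l ^ 2) * (1 - p) ≤ 1 := by
  have hexp : ∀ y : ℝ, |y| ≤ 1 → Real.exp y ≤ 1 + y + y ^ 2 := fun y hy => by
    linarith [(abs_le.1 (Real.abs_exp_sub_one_sub_id_le hy)).2]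
  have h1 := hexp (l * (1 - p)) (by
    rw [abs_mul, abs_of_nonneg (by linarith : 0 ≤ 1 - p)]
    exact mul_le_one₀ hl (by linarith) (by linarith))
  have h2 := hexp (l * (0 - p)) (by
    rw [abs_mul, zero_sub, abs_neg, abs_of_nonneg hp0]
    exact mul_le_one₀ hl hp0 hp1)
  rw [Real.exp_sub, Real.exp_sub, div_mul_eq_mul_div, div_mul_eq_mul_div, ← add_div,
    div_le_one (Real.exp_pos _)]
  have h3 := Real.add_one_le_exp (l ^ 2)
  have h4 := mul_le_mul_of_nonneg_right h1 hp0
  have h5 := mul_le_mul_of_nonneg_right h2 (by linarith : 0 ≤ 1 - p)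
  have h6 : l ^ 2 * (p * (1 - p)) ≤ l ^ 2 * 1 := by
    gcongr
    nlinarith
  nlinarith

section Statistic

variable {A : Type*}

open Classical in
/-- The exponent of the exponential supermartingale that compares, over the first `T` starting
times from `h` on, the frequency of `a` after `w` with `p`. -/
noncomputable def tiltedSum {L : ℕ} (w : Fin L → A) (a : A) (p l : ℝ) (h T : ℕ)
    (x : ℕ → A) : ℝ :=
  ∑ j ∈ Finset.range T, if block x (h + j) L = w then
    l * ((if x (h + j + L) = a then 1 else 0) - p) - l ^ 2 else 0

lemma tiltedSum_eq {L : ℕ} (w : Fin L → A) (a : A) (p l : ℝ) (h n : ℕ) (x : ℕ → A) :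
    tiltedSum w a p l h (n + 1 - (h + L)) x
      = l * (occurrences x (Fin.snoc (α := fun _ => A) w a) h (n + 1) - p * occurrences x w h n)
        - l ^ 2 * occurrences x w h n := by
  classical
  rw [occurrences_eq_sum, occurrences_eq_sum, tiltedSum,
    show n + 1 + 1 - (h + (L + 1)) = n + 1 - (h + L) by omega]
  push_cast
  rw [Finset.mul_sum, ← Finset.sum_sub_distrib, Finset.mul_sum, Finset.mul_sum,
    ← Finset.sum_sub_distrib]
  refine Finset.sum_congr rfl fun j _ => ?_
  simp only [block_succ_eq_snoc_iff]
  by_cases h1 : block x (h + j) L = w <;> by_cases h2 : x (h + j + L) = a <;> simp [h1, h2]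

lemma tiltedSum_congr {L : ℕ} (w : Fin L → A) (a : A) (p l : ℝ) {h T t : ℕ} (ht : h + T + L ≤ t)
    {x y : ℕ → A} (hxy : ∀ j < t, x j = y j) :
    tiltedSum w a p l h T x = tiltedSum w a p l h T y := by
  unfold tiltedSum
  refine Finset.sum_congr rfl fun j hj => ?_
  rw [Finset.mem_range] at hj
  rw [block_congr hxy (by omega), hxy _ (by omega)]

/-- The tilt l = ε/2 maximises lε - l², with value ε²/4 per occurrence; the sign of l follows that
of the deviation. -/
lemma le_tiltedSum {L : ℕ} {w : Fin L → A} {a : A} {p ε m : ℝ} {h n : ℕ} {x : ℕ → A}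
    (hε : 0 ≤ ε) (hm : 0 ≤ m) (hocc : m < occurrences x w h n)
    (hdev : ε < |empCond x w a h n - p|) :
    ε ^ 2 / 4 * m ≤ tiltedSum w a p (ε / 2) h (n + 1 - (h + L)) x ∨
      ε ^ 2 / 4 * m ≤ tiltedSum w a p (-(ε / 2)) h (n + 1 - (h + L)) x := by
  rw [tiltedSum_eq, tiltedSum_eq]
  set N : ℝ := (occurrences x w h n : ℝ)
  have hN : 0 < N := hm.trans_lt hocc
  have hR : (occurrences x (Fin.snoc (α := fun _ => A) w a) h (n + 1) : ℝ)
      = empCond x w a h n * N := by rw [empCond, div_mul_cancel₀ _ hN.ne']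
  rw [hR]
  set q := empCond x w a h n
  have hm' : ε ^ 2 / 4 * m ≤ ε ^ 2 / 4 * N := by gcongr
  rcases lt_abs.1 hdev with h1 | h1
  · left
    have : ε / 2 * (ε * N) ≤ ε / 2 * ((q - p) * N) := by gcongr
    linarith
  · right
    have : ε / 2 * (ε * N) ≤ ε / 2 * (-(q - p) * N) := by gcongr
    linarith

/-- The sequences for which the empirical conditional probability of some seen word `w a` of
length `L + 1`, computed from more than `m` occurrences of `w`, is further than `ε`
from `p w a`. -/
def deviationSet (L n : ℕ) (m ε : ℝ) (p : (Fin L → A) → A → ℝ) : Set (ℕ → A) :=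
  {x | ∃ (w : Fin L → A) (a : A), 0 < occurrences x (Fin.snoc (α := fun _ => A) w a) 0 (half n) ∧
    m < occurrences x w (half n) n ∧ ε < |empCond x w a (half n) n - p w a|}

end Statistic

variable {A : Type*} [MeasurableSpace A] {μ : Measure (ℕ → A)}

/-- After every past of positive probability that ends in `w`, the conditional probability of
the letter `a` is `p`. -/
def HasContinuation (μ : Measure (ℕ → A)) {L : ℕ} (w : Fin L → A) (a : A) (p : ℝ) : Prop :=
  ∀ (s : ℕ) (u : Fin (s + L) → A), 0 < μ {x | block x 0 (s + L) = u} → lastLetters u = w →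
    transProb μ u a = p

lemma transProb_le_one [IsFiniteMeasure μ] {L : ℕ} (w : Fin L → A) (a : A) :
    transProb μ w a ≤ 1 :=
  div_le_one_of_le₀ (measureReal_mono fun _ hx => (block_succ_eq_snoc_iff.1 hx).1)
    measureReal_nonneg

variable [Countable A] [DiscreteMeasurableSpace A]

lemma hasContinuation_self [IsProbabilityMeasure μ] (hT : MeasurePreserving shift μ μ) {k : ℕ}
    (hk : HasMemory μ (fun n x => x n) k) (v : Fin k → A) (a : A) :
    HasContinuation μ v a (transProb μ v a) := by
  rintro s u hu rfl
  exact (hasMemory_iff hT k).1 hk s u a hu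

lemma hasContinuation_lastLetters [IsProbabilityMeasure μ] (hT : MeasurePreserving shift μ μ)
    {k i : ℕ} (hk : HasMemory μ (fun n x => x n) k) (b : Fin (i + k) → A) (a : A) :
    HasContinuation μ b a (transProb μ (lastLetters b) a) := by
  -- The length is a variable `m` because `s + (i + k)` and `s + i + k` are not definitionally
  -- equal.
  have key : ∀ (s m : ℕ) (hm : m = s + i + k) (u : Fin m → A), 0 < μ {x | block x 0 m = u} →
      (∀ j : Fin k, u ⟨s + i + j, by omega⟩ = lastLetters b j) →
      transProb μ u a = transProb μ (lastLetters b) a := by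
    rintro s _ rfl u hu h
    rw [(hasMemory_iff hT k).1 hk (s + i) u a hu]
    congr 1
    ext j
    exact h j
  rintro s u hu rfl
  refine key s (s + (i + k)) (by omega) u hu fun j => ?_
  simp only [lastLetters]
  congr 1
  ext
  simp [add_assoc]

lemma measurableSet_of_congr {t : ℕ} {R : (ℕ → A) → Prop}
    (h : ∀ x y : ℕ → A, (∀ j < t, x j = y j) → R x → R y) : MeasurableSet {x | R x} := by
  have : {x | R x} = (fun x => block x 0 t) ⁻¹' {u | ∃ x, R x ∧ block x 0 t = u} := by
    ext x
    refine ⟨fun hx => ⟨x, hx, rfl⟩, ?_⟩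
    rintro ⟨y, hy, hyx⟩
    refine h y x (fun j hj => ?_) hy
    simpa [block] using block_eq_iff.1 hyx ⟨j, hj⟩
  rw [this]
  exact measurable_block 0 t (Set.to_countable _).measurableSet

/-- Summing over the countably many cylinders of length `t` takes the place of conditional
expectation given the first `t` letters. -/
lemma lintegral_eq_tsum_block (t : ℕ) (f : (ℕ → A) → ENNReal) :
    ∫⁻ x, f x ∂μ = ∑' u : Fin t → A, ∫⁻ x in {x | block x 0 t = u}, f x ∂μ := by
  rw [← lintegral_iUnion (fun u => measurableSet_block 0 u), ← setLIntegral_univ]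
  · congr 2
    ext x
    simp
  · intro u v huv
    exact Set.disjoint_left.2 fun x hx hx' => huv (hx.symm.trans hx')

open Classical in
lemma setLIntegral_exp_le [IsProbabilityMeasure μ] {t : ℕ} (u : Fin t → A)
    (hu : 0 < μ {x | block x 0 t = u}) (a : A) {l : ℝ} (hl : |l| ≤ 1) :
    ∫⁻ x in {x | block x 0 t = u},
      ENNReal.ofReal (Real.exp (l * ((if x t = a then 1 else 0) - transProb μ u a) - l ^ 2)) ∂μ
      ≤ μ {x | block x 0 t = u} := by
  set p := transProb μ u a with hp
  set E := {x : ℕ → A | block x 0 t = u} with hE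
  set D := {x : ℕ → A | x t = a} with hD
  have hDm : MeasurableSet D := measurableSet_coord t a
  have hpos : 0 < μ.real E := ENNReal.toReal_pos hu.ne' (measure_ne_top _ _)
  have hDE : μ.real (D ∩ E) = p * μ.real E := by
    have := block_inter_coord 0 u a
    rw [Nat.zero_add, Set.inter_comm] at this
    rw [hE, hD, this, hp, transProb, div_mul_cancel₀ _ hpos.ne']
  have hDE' : μ.real (Dᶜ ∩ E) = (1 - p) * μ.real E := by
    have := measureReal_inter_add_sdiff (μ := μ) (s := E) hDm
    rw [Set.inter_comm, hDE, Set.sdiff_eq, Set.inter_comm] at this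
    linarith
  have hp0 : 0 ≤ p := transProb_nonneg u a
  have hp1 : p ≤ 1 := transProb_le_one u a
  rw [← lintegral_add_compl _ hDm,
    setLIntegral_congr_fun hDm (g := fun _ => ENNReal.ofReal (Real.exp (l * (1 - p) - l ^ 2)))
      (fun x hx => by rw [if_pos (show x t = a from hx)]),
    setLIntegral_congr_fun hDm.compl
      (g := fun _ => ENNReal.ofReal (Real.exp (l * (0 - p) - l ^ 2)))
      (fun x hx => by rw [if_neg (show ¬ x t = a from hx)]),
    setLIntegral_const, setLIntegral_const, Measure.restrict_apply hDm,
    Measure.restrict_apply hDm.compl, ← ofReal_measureReal (s := D ∩ E),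
    ← ofReal_measureReal (s := Dᶜ ∩ E), ← ofReal_measureReal (s := E), hDE, hDE',
    ← ENNReal.ofReal_mul (Real.exp_nonneg _), ← ENNReal.ofReal_mul (Real.exp_nonneg _),
    ← ENNReal.ofReal_add (by positivity)
      (mul_nonneg (Real.exp_nonneg _) (mul_nonneg (by linarith) hpos.le))]
  refine ENNReal.ofReal_le_ofReal ?_
  have := mul_le_mul_of_nonneg_right (two_point_exp_le hp0 hp1 hl) hpos.le
  linarith

open Classical in
-- The supermartingale step. On a cylinder of length `s + L` both `f` and the test for `w` are
-- constant: either the factor is 1, or the past ends in `w` and the next letter is `a` with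
-- probability `p`.
lemma lintegral_mul_exp_le [IsProbabilityMeasure μ] {L : ℕ} {w : Fin L → A} {a : A} {p : ℝ}
    (hw : HasContinuation μ w a p) (s : ℕ) {l : ℝ} (hl : |l| ≤ 1) {f : (ℕ → A) → ENNReal}
    (hf : ∀ x y : ℕ → A, (∀ j < s + L, x j = y j) → f x = f y) :
    ∫⁻ x, f x * ENNReal.ofReal (Real.exp (if block x s L = w then
      l * ((if x (s + L) = a then 1 else 0) - p) - l ^ 2 else 0)) ∂μ ≤ ∫⁻ x, f x ∂μ := by
  rw [lintegral_eq_tsum_block (s + L), lintegral_eq_tsum_block (s + L) f]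
  refine ENNReal.tsum_le_tsum fun u => ?_
  have hum := measurableSet_block 0 u
  rcases eq_zero_or_pos (μ {x | block x 0 (s + L) = u}) with hu | hu
  · rw [setLIntegral_measure_zero _ _ hu]
    exact zero_le
  obtain ⟨x₀, hx₀⟩ := nonempty_of_measure_ne_zero hu.ne'
  have hagree : ∀ x ∈ {x | block x 0 (s + L) = u}, ∀ j < s + L, x j = x₀ j := by
    intro x hx j hj
    have := block_eq_iff.1 ((show block x 0 (s + L) = u from hx).trans
      (show block x₀ 0 (s + L) = u from hx₀).symm) ⟨j, hj⟩
    simpa [block] using this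
  by_cases hb : block x₀ s L = w
  · have hlast : lastLetters u = w := by
      rw [← hb, ← show block x₀ 0 (s + L) = u from hx₀, lastLetters_block, Nat.zero_add]
    obtain rfl := hw s u hu hlast
    rw [setLIntegral_congr_fun hum (g := fun x => f x₀ * ENNReal.ofReal (Real.exp
        (l * ((if x (s + L) = a then 1 else 0) - transProb μ u a) - l ^ 2)))
        (fun x hx => by
          rw [hf x x₀ (hagree x hx), block_congr (hagree x hx) le_rfl, if_pos hb]),
      setLIntegral_congr_fun hum (g := fun _ => f x₀) (fun x hx => hf x x₀ (hagree x hx)),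
      setLIntegral_const]
    rw [lintegral_const_mul]
    · gcongr
      exact setLIntegral_exp_le u hu a hl
    · refine ENNReal.measurable_ofReal.comp (Real.measurable_exp.comp ?_)
      exact (((Measurable.ite (measurableSet_coord _ a) measurable_const
        measurable_const).sub_const _).const_mul _).sub_const _
  · refine le_of_eq (setLIntegral_congr_fun hum fun x hx => ?_)
    rw [block_congr (hagree x hx) le_rfl, if_neg hb, Real.exp_zero, ENNReal.ofReal_one, mul_one]

/-- The weight `f` will be the indicator of an event in the first half; it keeps the probability of
that event as a factor in the bound. -/
lemma lintegral_mul_exp_tiltedSum_le [IsProbabilityMeasure μ] {L : ℕ} {w : Fin L → A} {a : A}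
    {p : ℝ} (hw : HasContinuation μ w a p) (h : ℕ) {l : ℝ} (hl : |l| ≤ 1)
    {f : (ℕ → A) → ENNReal} (hf : ∀ x y : ℕ → A, (∀ j < h, x j = y j) → f x = f y) (T : ℕ) :
    ∫⁻ x, f x * ENNReal.ofReal (Real.exp (tiltedSum w a p l h T x)) ∂μ ≤ ∫⁻ x, f x ∂μ := by
  classical
  induction T with
  | zero => simp [tiltedSum]
  | succ T ih =>
    refine le_trans (le_of_eq ?_) ((lintegral_mul_exp_le hw (h + T) hl
      (f := fun x => f x * ENNReal.ofReal (Real.exp (tiltedSum w a p l h T x))) ?_).trans ih)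
    · congr 1
      ext x
      rw [mul_assoc, ← ENNReal.ofReal_mul (Real.exp_nonneg _), ← Real.exp_add]
      simp only [tiltedSum, Finset.sum_range_succ]
    · intro x y hxy
      rw [hf x y fun j hj => hxy j (by omega), tiltedSum_congr w a p l le_rfl hxy]

/-- A Chernoff bound for the exponential supermartingale, on an event that is determined
by the first `h` letters. -/
lemma measure_inter_tiltedSum_ge_le [IsProbabilityMeasure μ] {L : ℕ} {w : Fin L → A} {a : A}
    {p : ℝ} (hw : HasContinuation μ w a p) (h : ℕ) {l : ℝ} (hl : |l| ≤ 1)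
    {F : Set (ℕ → A)} (hF : ∀ x y : ℕ → A, (∀ j < h, x j = y j) → x ∈ F → y ∈ F) (T : ℕ) (c : ℝ) :
    μ {x | x ∈ F ∧ c ≤ tiltedSum w a p l h T x} ≤ ENNReal.ofReal (Real.exp (-c)) * μ F := by
  classical
  have hFm : MeasurableSet F := measurableSet_of_congr (R := (· ∈ F)) hF
  have hGm : MeasurableSet {x | x ∈ F ∧ c ≤ tiltedSum w a p l h T x} := by
    refine measurableSet_of_congr (t := h + T + L) fun x y hxy hx => ?_
    rw [← tiltedSum_congr w a p l le_rfl hxy]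
    exact ⟨hF x y (fun j hj => hxy j (by omega)) hx.1, hx.2⟩
  have hle := lintegral_mul_exp_tiltedSum_le hw h hl (f := F.indicator 1) (fun x y hxy => by
    have : x ∈ F ↔ y ∈ F := ⟨hF x y hxy, hF y x fun j hj => (hxy j hj).symm⟩
    simp [Set.indicator_apply, this]) T
  rw [lintegral_indicator_one hFm] at hle
  rw [← lintegral_indicator_one hGm]
  refine le_trans ?_ (mul_le_mul_right hle _)
  rw [← lintegral_const_mul' _ _ ENNReal.ofReal_ne_top]
  refine lintegral_mono fun x => ?_
  by_cases hx : x ∈ F ∧ c ≤ tiltedSum w a p l h T x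
  · rw [Set.indicator_of_mem (show x ∈ {x | x ∈ F ∧ c ≤ tiltedSum w a p l h T x} from hx),
      Set.indicator_of_mem hx.1, Pi.one_apply, one_mul,
      ← ENNReal.ofReal_mul (Real.exp_nonneg _), ← Real.exp_add, ENNReal.one_le_ofReal]
    exact Real.one_le_exp (by linarith [hx.2])
  · rw [Set.indicator_of_notMem (show x ∉ {x | x ∈ F ∧ c ≤ tiltedSum w a p l h T x} from hx)]
    exact zero_le

/-- The factor n + 1 counts positions in the first half and 2 the signs of the tilt; the number of
words does not enter. -/
lemma measure_deviationSet_le [IsProbabilityMeasure μ] {L : ℕ} (n : ℕ) {m ε : ℝ} (hm : 0 ≤ m)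
    (hε0 : 0 ≤ ε) (hε1 : ε ≤ 1) {p : (Fin L → A) → A → ℝ}
    (hp : ∀ w a, HasContinuation μ w a (p w a)) :
    μ (deviationSet L n m ε p)
      ≤ ENNReal.ofReal ((n + 1) * (2 * Real.exp (-(ε ^ 2 / 4 * m)))) := by
  set c := ε ^ 2 / 4 * m
  set C := ENNReal.ofReal (Real.exp (-c))
  set F : ℕ → (Fin L → A) × A → Set (ℕ → A) := fun s v =>
    {x | s + (L + 1) ≤ half n ∧ block x s (L + 1) = Fin.snoc (α := fun _ => A) v.1 v.2} with hF
  set G : ℝ → ℕ → (Fin L → A) × A → Set (ℕ → A) := fun l s v =>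
    {x | x ∈ F s v ∧ c ≤ tiltedSum v.1 v.2 (p v.1 v.2) l (half n) (n + 1 - (half n + L)) x} with hG
  have hsub : deviationSet L n m ε p ⊆
      ⋃ s ∈ Finset.range (n + 1), ⋃ v, (G (ε / 2) s v ∪ G (-(ε / 2)) s v) := by
    rintro x ⟨w, a, hseen, hocc, hdev⟩
    obtain ⟨s, hs, hx⟩ := occurrences_pos_iff.1 hseen
    have hsn := half_le n
    simp only [Set.mem_iUnion, Finset.mem_range]
    refine ⟨s, by omega, (w, a), ?_⟩
    rcases le_tiltedSum hε0 hm hocc hdev with h | h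
    · exact Or.inl ⟨⟨hs, hx⟩, h⟩
    · exact Or.inr ⟨⟨hs, hx⟩, h⟩
  have hFcongr : ∀ s v (x y : ℕ → A), (∀ j < half n, x j = y j) → x ∈ F s v → y ∈ F s v := by
    rintro s v x y hxy ⟨h1, h2⟩
    exact ⟨h1, by rw [← block_congr hxy h1]; exact h2⟩
  have hGle : ∀ l : ℝ, |l| ≤ 1 → ∀ s v, μ (G l s v) ≤ C * μ (F s v) := fun l hl s v =>
    measure_inter_tiltedSum_ge_le (hp v.1 v.2) (half n) hl (hFcongr s v) _ c
  -- At one position only one word can stand, so these events are disjoint.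
  have hFsum : ∀ s, ∑' v, μ (F s v) ≤ 1 := by
    intro s
    rw [← measure_iUnion]
    · exact prob_le_one
    · intro v v' hvv
      refine Set.disjoint_left.2 fun x hx hx' => hvv ?_
      have h1 := block_succ_eq_snoc_iff.1 hx.2
      have h2 := block_succ_eq_snoc_iff.1 hx'.2
      exact Prod.ext (h1.1.symm.trans h2.1) (h1.2.symm.trans h2.2)
    · exact fun v => measurableSet_of_congr (R := (· ∈ F s v)) (hFcongr s v)
  have hl : |ε / 2| ≤ 1 := by rw [abs_of_nonneg (by positivity)]; linarith
  calc μ (deviationSet L n m ε p)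
      ≤ ∑ s ∈ Finset.range (n + 1), ∑' v, 2 * C * μ (F s v) := by
        refine (measure_mono hsub).trans ((measure_biUnion_finset_le _ _).trans
          (Finset.sum_le_sum fun s _ => (measure_iUnion_le _).trans
            (ENNReal.tsum_le_tsum fun v => (measure_union_le _ _).trans ?_)))
        rw [mul_assoc, two_mul]
        exact add_le_add (hGle _ hl s v) (hGle _ (by rwa [abs_neg]) s v)
    _ ≤ ∑ s ∈ Finset.range (n + 1), 2 * C * 1 := by
        refine Finset.sum_le_sum fun s _ => ?_
        rw [ENNReal.tsum_mul_left]
        gcongr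
        exact hFsum s
    _ = _ := by
        rw [Finset.sum_const, Finset.card_range, nsmul_eq_mul, mul_one,
          ENNReal.ofReal_mul (by positivity), ENNReal.ofReal_mul zero_le_two,
          ENNReal.ofReal_add (by positivity) zero_le_one]
        simp [C]

lemma summable_mul_exp_neg_rpow {δ : ℝ} (hδ : 0 < δ) :
    Summable fun n : ℕ => ((n : ℝ) + 2) * ((n + 1) * (2 * Real.exp (-((n : ℝ) ^ δ / 16)))) := by
  -- At y = n^δ this power is n^(-4), which leaves n^(-2) after the quadratic prefactor.
  have h1 : (fun y : ℝ => Real.exp (-(1 / 16) * y)) =o[atTop] fun y => y ^ (-(4 / δ)) :=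
    isLittleO_exp_neg_mul_rpow_atTop (by norm_num) _
  have h2 := (h1.comp_tendsto ((tendsto_rpow_atTop hδ).comp
    tendsto_natCast_atTop_atTop)).eventuallyLE
  refine Summable.of_norm_bounded_eventually_nat (g := fun n : ℕ => 12 * ((n : ℝ) ^ 2)⁻¹)
    ((Real.summable_nat_pow_inv.2 one_lt_two).mul_left 12) ?_
  filter_upwards [h2, eventually_ge_atTop 1] with n hn hn1
  have hn1' : (1 : ℝ) ≤ n := by exact_mod_cast hn1
  have hn0 : (0 : ℝ) < n := by linarith
  simp only [Function.comp, Real.norm_eq_abs, Real.abs_exp] at hn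
  rw [← Real.rpow_mul hn0.le, show δ * -(4 / δ) = ((-4 : ℤ) : ℝ) by field_simp; norm_num,
    Real.rpow_intCast, abs_of_pos (by positivity)] at hn
  rw [Real.norm_of_nonneg (by positivity), show -((n : ℝ) ^ δ / 16) = -(1 / 16) * (n : ℝ) ^ δ by ring]
  calc ((n : ℝ) + 2) * ((n + 1) * (2 * Real.exp (-(1 / 16) * (n : ℝ) ^ δ)))
      ≤ (3 * n) * ((2 * n) * (2 * (n : ℝ) ^ (-4 : ℤ))) := by
        gcongr <;> linarith
    _ = 12 * ((n : ℝ) ^ 2)⁻¹ := by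
        rw [zpow_neg]
        have : (n : ℝ) ^ (4 : ℤ) = n ^ 4 := by norm_cast
        rw [this]
        field_simp
        norm_num

/-- If the process has memory `k`, then `k` is eventually accepted. -/
theorem ae_eventually_deltaHat_le [IsProbabilityMeasure μ] (hT : MeasurePreserving shift μ μ)
    {k : ℕ} (hk : HasMemory μ (fun n x => x n) k) {γ β : ℝ} (hβ0 : 0 < β)
    (hβ1 : β < (1 - γ) / 2) :
    ∀ᵐ x ∂μ, ∀ᶠ n : ℕ in atTop, deltaHat γ x n k ≤ (n : ℝ) ^ (-β) := by
  set m : ℕ → ℝ := fun n => (n : ℝ) ^ (1 - γ) with hm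
  -- Half the threshold, since a deviation is the sum of two errors about the same limit.
  set ε : ℕ → ℝ := fun n => (n : ℝ) ^ (-β) / 2 with hε
  set E : ℕ → Set (ℕ → A) := fun n =>
    deviationSet k n (m n) (ε n) (fun v a => transProb μ v a) ∪
      ⋃ i ∈ Finset.range (n + 1),
        deviationSet (i + k) n (m n) (ε n) (fun b a => transProb μ (lastLetters b) a) with hE
  set r : ℕ → ℝ := fun n => (n + 1) * (2 * Real.exp (-((n : ℝ) ^ (1 - γ - 2 * β) / 16))) with hr
  have hdevle : ∀ n : ℕ, 1 ≤ n → ∀ {L : ℕ} {p : (Fin L → A) → A → ℝ},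
      (∀ w a, HasContinuation μ w a (p w a)) →
      μ (deviationSet L n (m n) (ε n) p) ≤ ENNReal.ofReal (r n) := by
    intro n hn L p hp
    have hn1 : (1 : ℝ) ≤ n := by exact_mod_cast hn
    have hn0 : (0 : ℝ) < n := by linarith
    have h1 : (n : ℝ) ^ (-β) ≤ 1 := Real.rpow_le_one_of_one_le_of_nonpos hn1 (by linarith)
    refine (measure_deviationSet_le n (by positivity) (by positivity)
      (by simp only [hε]; linarith) hp).trans (le_of_eq ?_)
    have : ε n ^ 2 / 4 * m n = (n : ℝ) ^ (1 - γ - 2 * β) / 16 := by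
      rw [show 1 - γ - 2 * β = -β + -β + (1 - γ) by ring, Real.rpow_add hn0, Real.rpow_add hn0]
      simp only [hε, hm]
      ring
    rw [this]
  have hEle : ∀ n : ℕ, 1 ≤ n → μ (E n) ≤ ENNReal.ofReal ((n + 2) * r n) := by
    intro n hn
    have h1 := hdevle n hn (fun v a => hasContinuation_self hT hk v a)
    have h2 : μ (⋃ i ∈ Finset.range (n + 1), deviationSet (i + k) n (m n) (ε n)
        (fun b a => transProb μ (lastLetters b) a)) ≤ (n + 1 : ℕ) * ENNReal.ofReal (r n) := by
      refine (measure_biUnion_finset_le _ _).trans ((Finset.sum_le_card_nsmul _ _ _ fun i _ =>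
        hdevle n hn (fun b a => hasContinuation_lastLetters hT hk b a)).trans (le_of_eq ?_))
      rw [Finset.card_range, nsmul_eq_mul]
    refine (measure_union_le _ _).trans ((add_le_add h1 h2).trans (le_of_eq ?_))
    rw [ENNReal.ofReal_mul (p := (n : ℝ) + 2) (by positivity), show (n : ℝ) + 2 = ((n + 2 : ℕ) : ℝ) by push_cast; ring,
      ENNReal.ofReal_natCast]
    push_cast
    ring
  -- The sum starts at index 1, where the bound begins to hold; the exponent 1-γ-2β is positive
  -- because β < (1-γ)/2.
  have hsum : ∑' n, μ (E (n + 1)) ≠ ⊤ := by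
    have hs := (summable_nat_add_iff 1).2
      (summable_mul_exp_neg_rpow (by linarith : 0 < 1 - γ - 2 * β))
    refine ne_top_of_le_ne_top hs.tsum_ofReal_ne_top (ENNReal.tsum_le_tsum fun n => ?_)
    exact hEle (n + 1) (by omega)
  filter_upwards [ae_eventually_notMem hsum] with x hx
  obtain ⟨N, hN⟩ := eventually_atTop.1 hx
  filter_upwards [eventually_ge_atTop (N + 1)] with n hNn
  have hn := hN (n - 1) (by omega)
  rw [Nat.sub_add_cancel (by omega)] at hn
  refine deltaHat_le (by positivity) ?_
  rintro _ ⟨i, -, hi, b, a, ⟨hseen, hfreq⟩, rfl⟩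
  simp only [hE, Set.mem_union, Set.mem_iUnion, not_or, not_exists] at hn
  have hbocc : m n < occurrences x b (half n) n :=
    lt_of_lt_of_le hfreq (by exact_mod_cast occurrences_snoc_le x b a (half n) n)
  have hlocc : m n < occurrences x (lastLetters b) (half n) n :=
    hbocc.trans_le (by exact_mod_cast occurrences_le_lastLetters x b (half n) n)
  have h1 : |empCond x (lastLetters b) a (half n) n - transProb μ (lastLetters b) a| ≤ ε n := by
    by_contra! h
    exact hn.1 ⟨lastLetters b, a, seen_lastLetters hseen, hlocc, h⟩
  have h2 : |empCond x b a (half n) n - transProb μ (lastLetters b) a| ≤ ε n := by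
    by_contra! h
    exact hn.2 i (Finset.mem_range.2 (by omega)) ⟨b, a, hseen, hbocc, h⟩
  have h3 : (n : ℝ) ^ (-β) = ε n + ε n := by simp only [hε]; ring
  rw [h3]
  rw [abs_le] at *
  constructor <;> linarith [h1.1, h1.2, h2.1, h2.2]

end Deviations

/-! ### Consistency of the order estimator -/

section Consistency

variable {Ω A : Type*} [MeasurableSpace Ω] [Countable A] [MeasurableSpace A]
  [DiscreteMeasurableSpace A]

/-- Memory depends only on the law of the path, so the results on sequence space transfer to `S`. -/
lemma hasMemory_map_path_iff {P : Measure Ω} {S : ℕ → Ω → A} (hS : ∀ n, Measurable (S n)) (k : ℕ) :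
    HasMemory (P.map (path S)) (fun n x => x n) k ↔ HasMemory P S k := by
  have hpath : Measurable (path S) := measurable_pi_lambda _ hS
  have hcond : ∀ {C D : Set (ℕ → A)}, MeasurableSet C → MeasurableSet D →
      (P.map (path S))[D | C] = P[path S ⁻¹' D | path S ⁻¹' C] := by
    intro C D hC hD
    rw [cond_apply hC, cond_apply (hpath hC), Measure.map_apply hpath hC,
      Measure.map_apply hpath (hC.inter hD), Set.preimage_inter]
  unfold HasMemory
  refine forall_congr' fun i => forall_congr' fun b => forall_congr' fun a => ?_
  have h0 := Measure.map_apply (μ := P) hpath (measurableSet_block 0 b)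
  have h1 := hcond (measurableSet_block 0 b) (measurableSet_coord (i + k) a)
  have h2 := hcond (measurableSet_block i (lastLetters b)) (measurableSet_coord (i + k) a)
  change (0 < P.map (path S) {x | block x 0 (i + k) = b} →
    (P.map (path S))[{x | x (i + k) = a} | {x | block x 0 (i + k) = b}] =
      (P.map (path S))[{x | x (i + k) = a} | {x | block x i k = lastLetters b}]) ↔ _
  rw [h0, h1, h2]
  rfl

end Consistency

end MarkovOrder

theorem theorem2 {Ω A : Type*} [MeasurableSpace Ω] [Countable A] [MeasurableSpace A]
    [DiscreteMeasurableSpace A] (P : Measure Ω) [IsProbabilityMeasure P]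
    (S : ℕ → Ω → A) (hS : ∀ n, Measurable (S n))
    (hstat : MarkovOrder.IsStationary P S) (herg : MarkovOrder.IsErgodic P S)
    (γ β : ℝ) (hγ0 : 0 < γ) (hγ1 : γ < 1) (hβ0 : 0 < β) (hβ1 : β < (1 - γ) / 2) :
    (∀ k : ℕ, MarkovOrder.IsMarkovOfOrder P S k →
      ∀ᵐ ω ∂P, ∀ᶠ n in atTop, MarkovOrder.orderEst γ β (MarkovOrder.path S ω) n = k) ∧
    ((∀ k : ℕ, ¬ MarkovOrder.HasMemory P S k) →
      ∀ᵐ ω ∂P, Tendsto (fun n => MarkovOrder.orderEst γ β (MarkovOrder.path S ω) n)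
        atTop atTop) := 
by
  have hpath : Measurable (MarkovOrder.path S) := measurable_pi_lambda _ hS
  have : IsProbabilityMeasure (P.map (MarkovOrder.path S)) :=
    Measure.isProbabilityMeasure_map hpath.aemeasurable
  have hlower : ∀ k, ¬ MarkovOrder.HasMemory P S k → ∀ᵐ ω ∂P, ∀ᶠ n : ℕ in atTop,
      (n : ℝ) ^ (-β) < MarkovOrder.deltaHat γ (MarkovOrder.path S ω) n k := fun k hk =>
    ae_of_ae_map hpath.aemeasurable (MarkovOrder.ae_eventually_lt_deltaHat hstat herg
      (mt (MarkovOrder.hasMemory_map_path_iff hS k).1 hk) hγ0 hβ0)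
  constructor
  · intro k hk
    -- Minimality of `k` rules out every smaller memory; being finitely many, these are all rejected
    -- from a common time on.
    have hbelow : ∀ᵐ ω ∂P, ∀ j : Fin k, ∀ᶠ n : ℕ in atTop,
        (n : ℝ) ^ (-β) < MarkovOrder.deltaHat γ (MarkovOrder.path S ω) n j :=
      ae_all_iff.2 fun j => hlower j fun hj => absurd (hk.2 hj) (not_le.2 j.2)
    have habove : ∀ᵐ ω ∂P, ∀ᶠ n : ℕ in atTop,
        MarkovOrder.deltaHat γ (MarkovOrder.path S ω) n k ≤ (n : ℝ) ^ (-β) :=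
      ae_of_ae_map hpath.aemeasurable (MarkovOrder.ae_eventually_deltaHat_le hstat
        ((MarkovOrder.hasMemory_map_path_iff hS k).2 hk.1) hβ0 hβ1)
    filter_upwards [hbelow, habove] with ω h1 h2
    filter_upwards [eventually_all.2 h1, h2, eventually_gt_atTop k] with n h1 h2 hn
    exact le_antisymm (MarkovOrder.orderEst_le hn h2)
      (MarkovOrder.le_orderEst (by omega) fun j hj => h1 ⟨j, hj⟩)
  · intro hk
    filter_upwards [ae_all_iff.2 fun k => hlower k (hk k)] with ω h
    refine tendsto_atTop.2 fun k => ?_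
    filter_upwards [eventually_all.2 fun j : Fin k => h j, eventually_gt_atTop 0] with n h hn
    exact MarkovOrder.le_orderEst hn.ne' fun j hj => h ⟨j, hj⟩
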